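/- Let $d,k\ge 1$. For $x\in\mathbb S^d$ put $H_x=\{y\in\mathbb R^{d+1}:\langle x,y\rangle=0\}$. Let $\mathbb T^d_k$ be the space of all $\mathcal T=\mathcal T^x_{y_1,\dots,y_k}$, that is, of all tuples $(x,y_1,\dots,y_k)$ with $x\in\mathbb S^d$ and $y_1,\dots,y_k\in\mathbb S^d\cap H_x$, where the $y_i$ are pairwise distinct if $d\ge2$ (if $d=1$, when $\mathbb S^1\cap H_x$ has only two points, repetitions are allowed), with the topology induced from $(\mathbb S^d)^{k+1}$. The spherical tree $\mathcal T$ is the metric space obtained from the disjoint union of the $k$ great semicircles $r^x_{y_i}=\{\cos t\,x+\sin t\,y_i:0\le t\le\pi\}$, with points written $(t,r^x_{y_i})$, by identifying the $k$ points with $t=0$; its metric $d_{\mathcal T}$ is $|t-t'|$ for two points with coordinates $t,t'$ on the same semicircle and $t+t'$ for points on different semicircles. Let $\sigma$ be the probability distribution on $\mathbb T^d_k$ for which $x$ is uniform on $\mathbb S^d$ and, given $x$, the $y_i$ are independent and uniform on $\mathbb S^d\cap H_x$. The group $\operatorname{O}(d+1)$ acts on $\mathbb T^d_k$ by $g\mathcal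 T^x_{y_1,\dots,y_k}=\mathcal T^{gx}_{gy_1,\dots,gy_k}$. Let $\Delta_{k-1}\subset\mathbb R^k$ be the standard simplex, and let $\alpha:\mathbb S^d\times\mathbb T^d_k\to\Delta_{k-1}$ be an $\operatorname{O}(d+1)$-invariant splitting map, i.e. a continuous map with $\alpha(gy,g\mathcal T)=\alpha(y,\mathcal T)$ for all $g\in\operatorname{O}(d+1)$, $y\in\mathbb S^d$, $\mathcal T\in\mathbb T^d_k$. Write $\mathcal P(\mathbb S^d)$ for the set of Borel probability measures on $\mathbb S^d$. For $\mu\in\mathcal P(\mathbb S^d)$ and $\mathcal T=\mathcal T^x_{y_1,\dots,y_k}$ let $\mathcal R^\alpha_{\mathcal T}\mu$ be the probability measure on $\mathcal T$ $$\mathcal R^\alpha_{\mathcal T}\mu=\sum_{i=1}^k\bigl(y\mapsto(\arccos\langle x,y\rangle,\,r^x_{y_i})\bigr)_\sharp\bigl(\alpha(\cdot,\mathcal T)_i\,\mu\bigr),$$ and let $W_{d_{\mathcal T},1}$ be the Wasserstein distance of order $1$ on $(\mathcal T,d_{\mathcal T})$ (the infimum of $\int d_{\mathcal T}\,d\pi$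 over all couplings $\pi$). Then for all $\mu,\nu\in\mathcal P(\mathbb S^d)$ the function $\mathcal T\mapsto W_{d_{\mathcal T},1}(\mathcal R^\alpha_{\mathcal T}\mu,\mathcal R^\alpha_{\mathcal T}\nu)$ is measurable on $\mathbb T^d_k$, and $$\mathrm{STSW}(\mu,\nu)=\int_{\mathbb T^d_k}W_{d_{\mathcal T},1}(\mathcal R^\alpha_{\mathcal T}\mu,\mathcal R^\alpha_{\mathcal T}\nu)\,d\sigma(\mathcal T)$$ is a (finite) metric on $\mathcal P(\mathbb S^d)$. Moreover, $\mathrm{STSW}(g_\sharp\mu,g_\sharp\nu)=\mathrm{STSW}(\mu,\nu)$ for every $g\in\operatorname{O}(d+1)$ and all $\mu,\nu\in\mathcal P(\mathbb S^d)$. -/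

import Mathlib

open MeasureTheory Set
open scoped ENNReal RealInnerProductSpace

noncomputable section

namespace STSW

/-! ### The sphere and the orthogonal group -/

/-- The Euclidean space of dimension `d + 1`. -/
abbrev Euc (d : ℕ) : Type := EuclideanSpace ℝ (Fin (d + 1))

/-- The unit sphere of dimension `d`. -/
abbrev Sph (d : ℕ) : Type := Metric.sphere (0 : Euc d) 1

/-- The orthogonal group of the ambient space: linear norm-preserving bijections. -/
abbrev Orth (d : ℕ) : Type := Euc d ≃ₗᵢ[ℝ] Euc d

/-- The action of an orthogonal transformation on the sphere. -/
def Orth.act {d : ℕ} (g : Orth d) (y : Sph d) : Sph d :=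
  ⟨g y, by simp⟩

theorem Orth.continuous_act {d : ℕ} (g : Orth d) : Continuous g.act :=
  Continuous.subtype_mk (g.continuous.comp continuous_subtype_val) _

/-- The push-forward of a Borel probability measure on the sphere under an orthogonal map. -/
def pushforward {d : ℕ} (g : Orth d) (μ : ProbabilityMeasure (Sph d)) :
    ProbabilityMeasure (Sph d) :=
  μ.map g.continuous_act.measurable.aemeasurable

/-! ### Spherical trees -/

/-- The space of spherical trees with `k` edges: a tree is given by its root `x` on the sphere and
the directions `y i` of its edges, unit vectors orthogonal to `x`. The directions are pairwise
distinct, except on the circle (`d = 1`), where there are only two directions at each root and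
repetitions are allowed. -/
def SphTree (d k : ℕ) : Type :=
  {p : Sph d × (Fin k → Sph d) //
    (∀ i, ⟪(p.1 : Euc d), (p.2 i : Euc d)⟫ = 0) ∧ (2 ≤ d → Function.Injective p.2)}

instance (d k : ℕ) : TopologicalSpace (SphTree d k) := instTopologicalSpaceSubtype

instance (d k : ℕ) : MeasurableSpace (SphTree d k) := Subtype.instMeasurableSpace

/-- The root of a spherical tree. -/
def SphTree.root {d k : ℕ} (T : SphTree d k) : Sph d := T.1.1

/-- The direction of the `i`-th edge of a spherical tree. -/
def SphTree.edge {d k : ℕ} (T : SphTree d k) (i : Fin k) : Sph d := T.1.2 i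

/-- An orthogonal transformation moves the tree with root `x` and edges `y i` to the tree with
root `g x` and edges `g (y i)`. -/
def Orth.actTree {d k : ℕ} (g : Orth d) (T : SphTree d k) : SphTree d k :=
  ⟨(g.act T.root, fun i => g.act (T.edge i)),
    fun i => by
      have h := T.2.1 i
      simpa [Orth.act, SphTree.root, SphTree.edge, LinearIsometryEquiv.inner_map_map] using h,
    fun hd i j hij => by
      refine T.2.2 hd (Subtype.ext (g.injective ?_))
      exact congrArg Subtype.val hij⟩

/-! ### The glued rays as a metric space

The spherical ray with root `x` and direction `y` is the great semicircle from `x` through `y` to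
`-x`. It is parametrized by `t ↦ cos t • x + sin t • y`, `0 ≤ t ≤ π`, an isometry whose inverse is
`z ↦ arccos ⟪x, z⟫`. A point of a tree is written in these coordinates as `(i, t)`: the point with
coordinate `t` on the `i`-th ray. The rays are disjoint, but for their common root `t = 0`. -/

/-- Points of the disjoint union of the `k` rays, in coordinates. -/
abbrev RayPoint (k : ℕ) : Type := Fin k × Icc (0 : ℝ) Real.pi

/-- The gluing relation: the points with coordinate `0` on all rays are identified. -/
def glueSetoid (k : ℕ) : Setoid (RayPoint k) where
  r a b := a = b ∨ ((a.2 : ℝ) = 0 ∧ (b.2 : ℝ) = 0)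
  iseqv :=
    { refl := fun _ => Or.inl rfl
      symm := by
        rintro a b (h | ⟨h, h'⟩)
        · exact Or.inl h.symm
        · exact Or.inr ⟨h', h⟩
      trans := by
        rintro a b c (rfl | ⟨h, h'⟩) (rfl | ⟨h₁, h₂⟩)
        · exact Or.inl rfl
        · exact Or.inr ⟨h₁, h₂⟩
        · exact Or.inr ⟨h, h'⟩
        · exact Or.inr ⟨h, h₂⟩ }

/-- The underlying space of a spherical tree with `k` edges, in the coordinates above. -/
def TreeSpace (k : ℕ) : Type := Quotient (glueSetoid k)

/-- The point with coordinate `t` on the `i`-th ray. -/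
def TreeSpace.mk {k : ℕ} (i : Fin k) (t : Icc (0 : ℝ) Real.pi) : TreeSpace k :=
  Quotient.mk (glueSetoid k) (i, t)

/-- The tree distance before gluing. -/
def rayDist {k : ℕ} (a b : RayPoint k) : ℝ :=
  if a.1 = b.1 then |(a.2 : ℝ) - b.2| else (a.2 : ℝ) + b.2

theorem rayDist_self {k : ℕ} (a : RayPoint k) : rayDist a a = 0 := by
  simp [rayDist]

theorem rayDist_comm {k : ℕ} (a b : RayPoint k) : rayDist a b = rayDist b a := by
  unfold rayDist
  by_cases h : a.1 = b.1
  · simp [h, abs_sub_comm]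
  · simp [h, Ne.symm h, add_comm]

theorem rayDist_triangle {k : ℕ} (a b c : RayPoint k) :
    rayDist a c ≤ rayDist a b + rayDist b c := by
  have ha := a.2.2.1
  have hb := b.2.2.1
  have hc := c.2.2.1
  unfold rayDist
  split_ifs with h₁ h₂ h₃ h₂ h₃ h₃ <;>
    first
    | exact absurd (h₂.trans h₃) h₁
    | exact absurd (h₂.symm.trans h₁) h₃
    | exact absurd (h₁.trans h₃.symm) h₂
    | grind

theorem rayDist_eq_zero {k : ℕ} {a b : RayPoint k} (h : rayDist a b = 0) :
    (glueSetoid k).r a b := by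
  have ha := a.2.2.1
  have hb := b.2.2.1
  unfold rayDist at h
  split_ifs at h with h₁
  · left
    exact Prod.ext h₁ (Subtype.ext (sub_eq_zero.mp (abs_eq_zero.mp h)))
  · right
    constructor <;> linarith

theorem rayDist_glue {k : ℕ} {a b : RayPoint k} (h : (glueSetoid k).r a b) :
    rayDist a b = 0 := by
  rcases h with rfl | ⟨h, h'⟩
  · exact rayDist_self a
  · simp [rayDist, h, h']

theorem rayDist_congr {k : ℕ} (a b a' b' : RayPoint k) (h : (glueSetoid k).r a a')
    (h' : (glueSetoid k).r b b') : rayDist a b = rayDist a' b' := by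
  have e₁ := rayDist_glue h
  have e₂ := rayDist_glue h'
  have f₁ := rayDist_comm a a'
  have f₂ := rayDist_comm b b'
  have t₁ := rayDist_triangle a a' b
  have t₂ := rayDist_triangle a' b' b
  have t₃ := rayDist_triangle a' a b'
  have t₄ := rayDist_triangle a b b'
  linarith

/-- The tree metric: `|t - t'|` for two points with coordinates `t`, `t'` on the same ray, and
`t + t'` for points on different rays. -/
instance (k : ℕ) : MetricSpace (TreeSpace k) where
  dist := Quotient.lift₂ rayDist rayDist_congr
  dist_self := by
    rintro ⟨a⟩
    exact rayDist_self a
  dist_comm := by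
    rintro ⟨a⟩ ⟨b⟩
    exact rayDist_comm a b
  dist_triangle := by
    rintro ⟨a⟩ ⟨b⟩ ⟨c⟩
    exact rayDist_triangle a b c
  eq_of_dist_eq_zero := by
    rintro ⟨a⟩ ⟨b⟩ h
    exact Quotient.sound (rayDist_eq_zero h)

instance (k : ℕ) : MeasurableSpace (TreeSpace k) := borel _

instance (k : ℕ) : BorelSpace (TreeSpace k) := ⟨rfl⟩

/-! ### The distribution on the space of trees -/

/-- The uniform probability distribution on the unit sphere of a Euclidean space. -/
def uniformSphere (F : Type*) [NormedAddCommGroup F] [InnerProductSpace ℝ F]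
    [FiniteDimensional ℝ F] [MeasurableSpace F] [BorelSpace F] :
    Measure (Metric.sphere (0 : F) 1) :=
  ((volume : Measure F).toSphere univ)⁻¹ • (volume : Measure F).toSphere

/-- The uniform probability distribution on the unit vectors orthogonal to `x`, as a measure on
the sphere that contains them. -/
def uniformDirection {d : ℕ} (x : Sph d) : Measure (Sph d) :=
  (uniformSphere ↥(Submodule.span ℝ {(x : Euc d)})ᗮ).map
    fun v : Metric.sphere (0 : ↥(Submodule.span ℝ {(x : Euc d)})ᗮ) 1 =>
      (⟨(v.1 : Euc d), by
        have h := v.2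
        rw [mem_sphere_zero_iff_norm] at h ⊢
        exact h⟩ : Sph d)

/-- The law of `(x, y)` where the root `x` is uniform on the sphere and, given `x`, the directions
`y i` are independent and uniform on the unit vectors orthogonal to `x`. -/
def rootedLaw (d k : ℕ) : Measure (Sph d × (Fin k → Sph d)) :=
  (uniformSphere (Euc d)).bind fun x =>
    (Measure.pi fun _ : Fin k => uniformDirection x).map fun y => (x, y)

/-- The distribution on the space of spherical trees. -/
def treeLaw (d k : ℕ) : Measure (SphTree d k) :=
  (rootedLaw d k).comap Subtype.val

/-! ### Splitting maps and the Radon transform -/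

/-- Splitting maps: continuous maps to the standard simplex. -/
abbrev SplittingMap (d k : ℕ) : Type := C(Sph d × SphTree d k, stdSimplex ℝ (Fin k))

/-- Invariance of a splitting map under the orthogonal group. -/
def SplittingMap.IsInvariant {d k : ℕ} (α : SplittingMap d k) : Prop :=
  ∀ (g : Orth d) (y : Sph d) (T : SphTree d k), α (g.act y, g.actTree T) = α (y, T)

/-- The spherical distance `arccos ⟪x, y⟫`. -/
def sphCoord {d : ℕ} (x y : Sph d) : Icc (0 : ℝ) Real.pi :=
  ⟨Real.arccos ⟪(x : Euc d), (y : Euc d)⟫, Real.arccos_nonneg _, Real.arccos_le_pi _⟩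

/-- The Radon transform of a measure on the sphere along a tree `T` with root `x`: the mass of `μ`
at `y` is moved to the points with coordinate `arccos ⟪x, y⟫` on the `k` rays, the fraction
`α (y, T) i` of it to the `i`-th ray. -/
def radon {d k : ℕ} (α : SplittingMap d k) (T : SphTree d k) (μ : Measure (Sph d)) :
    Measure (TreeSpace k) :=
  ∑ i, (μ.withDensity fun y => ENNReal.ofReal ((α (y, T) : Fin k → ℝ) i)).map
    fun y => TreeSpace.mk i (sphCoord T.root y)

/-! ### Wasserstein and spherical tree-sliced Wasserstein distances -/

/-- The Wasserstein distance of order one, as an infimum over all couplings. -/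
def wasserstein {X : Type*} [MetricSpace X] [MeasurableSpace X] (μ ν : Measure X) : ℝ≥0∞ :=
  ⨅ (π : Measure (X × X)) (_ : π.fst = μ ∧ π.snd = ν), ∫⁻ p, edist p.1 p.2 ∂π

/-- The Wasserstein distance between the Radon transforms along a tree. -/
def treeWasserstein {d k : ℕ} (α : SplittingMap d k) (μ ν : ProbabilityMeasure (Sph d))
    (T : SphTree d k) : ℝ≥0∞ :=
  wasserstein (radon α T μ) (radon α T ν)

/-- The spherical tree-sliced Wasserstein distance. -/
def stsw {d k : ℕ} (α : SplittingMap d k) (μ ν : ProbabilityMeasure (Sph d)) : ℝ≥0∞ :=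
  ∫⁻ T, treeWasserstein α μ ν T ∂(treeLaw d k)

/-- A function `D` with values in `[0, ∞]` is a metric: it is finite, and satisfies the axioms. -/
structure IsMetric {X : Type*} (D : X → X → ℝ≥0∞) : Prop where
  ne_top : ∀ a b, D a b ≠ ∞
  eq_zero_iff : ∀ a b, D a b = 0 ↔ a = b
  symm : ∀ a b, D a b = D b a
  triangle : ∀ a b c, D a c ≤ D a b + D b c

end STSW

end

open scoped ProbabilityTheory Pointwise

namespace STSW

/-! ### Order-one transport cost between measures on a metric space. -/

section Wasserstein

variable {X : Type*} [MetricSpace X] [MeasurableSpace X]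

/-! Each metric axiom is checked tree by tree and then integrated, except definiteness. The triangle
inequality on one tree is the gluing of couplings (`wasserstein_triangle`). Finiteness holds because
a tree has diameter at most 2π and the law of trees is a probability measure.

Measurability follows from continuity in the tree. Moving the root shifts each mass along its ray,
and changing the splitting only transports the excess of one density over the other
(`wasserstein_radon_le`). Both effects are uniform over the compact sphere.

Definiteness does not depend on how α splits the mass: distance to the root is a 1-Lipschitz
function on the tree, and it pushes the Radon transform of μ to the law of arccos ⟪x, y⟫ under μ
(`integral_radon`). If the distance vanishes on a tree with root x, the integrals of exp(i t cos s)
against these laws agree, so the characteristic functions of μ and ν agree on the line through x.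
Almost every root is of this kind; the set of such x is closed and the uniform law charges every
nonempty open set, so all x are. Characteristic functions then determine the measures.

For orthogonal invariance, `radon_act` turns invariance of α into equivariance of the Radon
transform, and `map_actTree_treeLaw` says that the law of trees is preserved. This requires the law
to be a genuine mixture (`measurable_fiberLaw`) carried by the admissible tuples (`ae_fiberLaw`). -/

theorem wasserstein_le {μ ν : Measure X} {π : Measure (X × X)} (h₁ : π.fst = μ)
    (h₂ : π.snd = ν) : wasserstein μ ν ≤ ∫⁻ p, edist p.1 p.2 ∂π :=
  iInf₂_le (f := fun (π : Measure (X × X)) (_ : π.fst = μ ∧ π.snd = ν) =>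
    ∫⁻ p, edist p.1 p.2 ∂π) π ⟨h₁, h₂⟩

theorem le_wasserstein {μ ν : Measure X} {c : ℝ≥0∞}
    (h : ∀ π : Measure (X × X), π.fst = μ → π.snd = ν → c ≤ ∫⁻ p, edist p.1 p.2 ∂π) :
    c ≤ wasserstein μ ν :=
  le_iInf₂ fun π hπ => h π hπ.1 hπ.2

theorem exists_coupling_lt {μ ν : Measure X} {c : ℝ≥0∞} (h : wasserstein μ ν < c) :
    ∃ π : Measure (X × X), π.fst = μ ∧ π.snd = ν ∧ ∫⁻ p, edist p.1 p.2 ∂π < c := by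
  unfold wasserstein at h
  simp only [iInf_lt_iff] at h
  obtain ⟨π, ⟨h₁, h₂⟩, h₃⟩ := h
  exact ⟨π, h₁, h₂, h₃⟩

theorem wasserstein_add_le (μ μ' ν ν' : Measure X) :
    wasserstein (μ + μ') (ν + ν') ≤ wasserstein μ ν + wasserstein μ' ν' := by
  refine le_of_forall_gt fun c hc => ?_
  obtain ⟨a, ha, b, hb, hab⟩ : ∃ a > wasserstein μ ν, ∃ b > wasserstein μ' ν', a + b < c :=
    ENNReal.exists_add_lt_of_add_lt hc
  obtain ⟨π, h₁, h₂, h₃⟩ := exists_coupling_lt ha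
  obtain ⟨π', h₁', h₂', h₃'⟩ := exists_coupling_lt hb
  refine (wasserstein_le (π := π + π') ?_ ?_).trans_lt ?_
  · rw [Measure.fst_add, h₁, h₁']
  · rw [Measure.snd_add, h₂, h₂']
  · rw [lintegral_add_measure]
    exact (ENNReal.add_lt_add h₃ h₃').trans hab

variable [OpensMeasurableSpace X] [SecondCountableTopology X]

theorem wasserstein_map_le {Ω : Type*} [MeasurableSpace Ω] (ρ : Measure Ω) {f g : Ω → X}
    (hf : Measurable f) (hg : Measurable g) :
    wasserstein (ρ.map f) (ρ.map g) ≤ ∫⁻ ω, edist (f ω) (g ω) ∂ρ := by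
  refine (wasserstein_le (π := ρ.map fun ω => (f ω, g ω)) ?_ ?_).trans_eq ?_
  · rw [Measure.fst_map_prodMk hg]
  · rw [Measure.snd_map_prodMk hf]
  · rw [lintegral_map (by fun_prop) (by fun_prop)]

theorem wasserstein_self (μ : Measure X) : wasserstein μ μ = 0 := by
  have := wasserstein_map_le μ measurable_id measurable_id
  simpa using this

theorem wasserstein_comm_le (μ ν : Measure X) : wasserstein ν μ ≤ wasserstein μ ν := by
  refine le_wasserstein fun π h₁ h₂ => ?_
  refine (wasserstein_le (π := π.map Prod.swap) ?_ ?_).trans_eq ?_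
  · rw [Measure.fst_map_swap, h₂]
  · rw [Measure.snd_map_swap, h₁]
  · rw [lintegral_map (by fun_prop) measurable_swap]
    simp [edist_comm]

theorem wasserstein_comm (μ ν : Measure X) : wasserstein μ ν = wasserstein ν μ :=
  (wasserstein_comm_le ν μ).antisymm (wasserstein_comm_le μ ν)

/-- The normalised product measure is a coupling of two measures of equal nonzero mass. -/
theorem wasserstein_le_of_edist_le {D : ℝ≥0∞} (hD : ∀ x y : X, edist x y ≤ D)
    {μ ν : Measure X} [IsFiniteMeasure μ] [IsFiniteMeasure ν] (h : μ univ = ν univ) :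
    wasserstein μ ν ≤ D * μ univ := by
  rcases eq_or_ne (μ univ) 0 with h0 | h0
  · rw [Measure.measure_univ_eq_zero.1 h0, Measure.measure_univ_eq_zero.1 (h.symm.trans h0),
      wasserstein_self]
    exact zero_le
  have ht := measure_ne_top μ univ
  have hc : (μ univ)⁻¹ * μ univ = 1 := ENNReal.inv_mul_cancel h0 ht
  refine (wasserstein_le (π := (μ univ)⁻¹ • μ.prod ν) ?_ ?_).trans ?_
  · rw [Measure.fst, Measure.map_smul, Measure.map_fst_prod, ← h, smul_smul, hc, one_smul]
  · rw [Measure.snd, Measure.map_smul, Measure.map_snd_prod, smul_smul, hc, one_smul]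
  · refine (lintegral_mono fun p : X × X => hD p.1 p.2).trans_eq ?_
    rw [lintegral_const, Measure.smul_apply, ← univ_prod_univ, Measure.prod_prod, ← h,
      smul_eq_mul, ← mul_assoc (μ univ)⁻¹, hc, one_mul]

/-- Gluing: disintegrate a coupling of ν with μ and one of ν with ρ over the common marginal ν, and
make the outer points conditionally independent given the middle one. -/
theorem wasserstein_triangle [StandardBorelSpace X] [Nonempty X] (μ ν ρ : Measure X)
    [IsFiniteMeasure μ] [IsFiniteMeasure ν] :
    wasserstein μ ρ ≤ wasserstein μ ν + wasserstein ν ρ := by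
  refine le_of_forall_gt fun c hc => ?_
  -- After the swap both couplings have ν as first marginal, the one over which `condKernel`
  -- disintegrates.
  rw [wasserstein_comm μ ν] at hc
  obtain ⟨a, ha, b, hb, hab⟩ := ENNReal.exists_add_lt_of_add_lt hc
  obtain ⟨π, h₁, h₂, h₃⟩ := exists_coupling_lt ha
  obtain ⟨π', h₁', h₂', h₃'⟩ := exists_coupling_lt hb
  have : IsFiniteMeasure π := ⟨by rw [← Measure.fst_univ, h₁]; exact measure_lt_top _ _⟩
  have : IsFiniteMeasure π' := ⟨by rw [← Measure.fst_univ, h₁']; exact measure_lt_top _ _⟩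
  have e : ν ⊗ₘ π.condKernel = π := by rw [← h₁]; exact π.disintegrate _
  have e' : ν ⊗ₘ π'.condKernel = π' := by rw [← h₁']; exact π'.disintegrate _
  set κ := π.condKernel
  set κ' := π'.condKernel
  have f₁ : (ν ⊗ₘ (κ.prod κ')).map (fun p => (p.1, p.2.1)) = π := by
    rw [← e]
    ext s hs
    rw [Measure.map_apply (by fun_prop) hs, Measure.compProd_apply hs,
      Measure.compProd_apply (hs.preimage (by fun_prop))]
    congr with x
    have : κ x = (κ.prod κ' x).fst := by
      rw [ProbabilityTheory.Kernel.prod_apply, Measure.fst_prod]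
    rw [this, Measure.fst_apply (hs.preimage (by fun_prop))]
    rfl
  have f₂ : (ν ⊗ₘ (κ.prod κ')).map (fun p => (p.1, p.2.2)) = π' := by
    rw [← e']
    ext s hs
    rw [Measure.map_apply (by fun_prop) hs, Measure.compProd_apply hs,
      Measure.compProd_apply (hs.preimage (by fun_prop))]
    congr with x
    have : κ' x = (κ.prod κ' x).snd := by
      rw [ProbabilityTheory.Kernel.prod_apply, Measure.snd_prod]
    rw [this, Measure.snd_apply (hs.preimage (by fun_prop))]
    rfl
  refine (wasserstein_le (π := (ν ⊗ₘ (κ.prod κ')).map Prod.snd) ?_ ?_).trans_lt ?_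
  · rw [← h₂, ← f₁, Measure.fst, Measure.snd, Measure.map_map measurable_fst measurable_snd,
      Measure.map_map measurable_snd (by fun_prop)]
    rfl
  · rw [← h₂', ← f₂, Measure.snd, Measure.snd, Measure.map_map measurable_snd measurable_snd,
      Measure.map_map measurable_snd (by fun_prop)]
    rfl
  · refine lt_of_le_of_lt ?_ ((ENNReal.add_lt_add h₃ h₃').trans hab)
    rw [← f₁, ← f₂, lintegral_map (by fun_prop) measurable_snd,
      lintegral_map (by fun_prop) (by fun_prop), lintegral_map (by fun_prop) (by fun_prop),
      ← lintegral_add_left (by fun_prop)]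
    exact lintegral_mono fun p => edist_triangle_left _ _ _

/-- The easy half of Kantorovich duality: under any coupling the difference of the integrals is the
integral of F p.1 - F p.2. -/
theorem edist_integral_le_wasserstein {μ ν : Measure X}
    {F : X → ℂ} {L : NNReal} (hF : LipschitzWith L F) (hL : L ≠ 0) (hμ : Integrable F μ)
    (hν : Integrable F ν) :
    edist (∫ x, F x ∂μ) (∫ x, F x ∂ν) ≤ wasserstein μ ν * L := by
  rw [← ENNReal.div_le_iff_le_mul (by simp [hL]) (by simp)]
  refine le_wasserstein fun π h₁ h₂ => ENNReal.div_le_of_le_mul ?_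
  have i₁ : Integrable (fun p : X × X => F p.1) π := by
    subst h₁
    exact hμ.comp_measurable measurable_fst
  have i₂ : Integrable (fun p : X × X => F p.2) π := by
    subst h₂
    exact hν.comp_measurable measurable_snd
  have e₁ : ∫ x, F x ∂μ = ∫ p, F p.1 ∂π := by
    subst h₁
    exact integral_map measurable_fst.aemeasurable hF.continuous.aestronglyMeasurable
  have e₂ : ∫ x, F x ∂ν = ∫ p, F p.2 ∂π := by
    subst h₂
    exact integral_map measurable_snd.aemeasurable hF.continuous.aestronglyMeasurable
  rw [e₁, e₂, edist_eq_enorm_sub, ← integral_sub i₁ i₂, mul_comm,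
    ← lintegral_const_mul _ (by fun_prop)]
  refine (enorm_integral_le_lintegral_enorm _).trans (lintegral_mono fun p => ?_)
  rw [← edist_eq_enorm_sub]
  exact hF p.1 p.2

end Wasserstein

/-! ### Geometry of the glued rays. -/

section TreeSpace

variable {k : ℕ}

theorem TreeSpace.dist_mk (i j : Fin k) (s t : Icc (0 : ℝ) Real.pi) :
    dist (TreeSpace.mk i s) (TreeSpace.mk j t) = rayDist (i, s) (j, t) :=
  rfl

theorem TreeSpace.dist_mk_same (i : Fin k) (s t : Icc (0 : ℝ) Real.pi) :
    dist (TreeSpace.mk i s) (TreeSpace.mk i t) = dist s t := by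
  simp [TreeSpace.dist_mk, rayDist, Subtype.dist_eq, Real.dist_eq]

theorem TreeSpace.isometry_mk (i : Fin k) : Isometry (TreeSpace.mk i) :=
  Isometry.of_dist_eq (TreeSpace.dist_mk_same i)

theorem TreeSpace.edist_le (a b : TreeSpace k) :
    edist a b ≤ ENNReal.ofReal (2 * Real.pi) := by
  rw [edist_dist]
  refine ENNReal.ofReal_le_ofReal ?_
  obtain ⟨i, s⟩ := a
  obtain ⟨j, t⟩ := b
  change rayDist (i, s) (j, t) ≤ _
  obtain ⟨s, hs⟩ := s
  obtain ⟨t, ht⟩ := t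
  unfold rayDist
  split_ifs
  · exact abs_le.2 ⟨by linarith [hs.1, hs.2, ht.1, ht.2], by linarith [hs.1, hs.2, ht.1, ht.2]⟩
  · linarith [hs.2, ht.2]

/-- The tree is a finite union of isometric images of [0, π]. Compactness supplies the second
countability and the standard Borel structure that gluing needs. -/
instance : CompactSpace (TreeSpace k) := by
  refine ⟨?_⟩
  have : (univ : Set (TreeSpace k)) = ⋃ i, range (TreeSpace.mk i) := by
    symm
    rw [eq_univ_iff_forall]
    rintro ⟨i, t⟩
    exact mem_iUnion.2 ⟨i, t, rfl⟩
  rw [this]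
  exact isCompact_iUnion fun i => isCompact_range (TreeSpace.isometry_mk i).continuous

instance : SecondCountableTopology (TreeSpace k) :=
  UniformSpace.secondCountable_of_separable _

/-- The distance of a point of the tree to the root. -/
def TreeSpace.radius (a : TreeSpace k) : ℝ :=
  Quotient.lift (s := glueSetoid k) (fun p => (p.2 : ℝ))
    (by
      rintro a b (rfl | ⟨h, h'⟩)
      · rfl
      · exact h.trans h'.symm) a

theorem TreeSpace.lipschitzWith_radius : LipschitzWith 1 (TreeSpace.radius (k := k)) := by
  refine LipschitzWith.of_dist_le_mul ?_
  rintro ⟨i, s, hs⟩ ⟨j, t, ht⟩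
  change |s - t| ≤ _ * rayDist (i, ⟨s, hs⟩) (j, ⟨t, ht⟩)
  unfold rayDist
  split_ifs
  · simp
  · simpa using abs_le.2 ⟨by linarith [hs.1, ht.1], by linarith [hs.1, ht.1]⟩

end TreeSpace

/-! ### Transport estimates for mass distributed over rays. -/

section Spread

variable {k : ℕ} {Ω : Type*} [MeasurableSpace Ω]

/-- The distribution of the mass of `ρ` over the `k` rays with densities `a i`, at the coordinate
`r`. -/
noncomputable def spread (ρ : Measure Ω) (a : Fin k → Ω → ℝ≥0∞) (r : Ω → Icc (0 : ℝ) Real.pi) :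
    Measure (TreeSpace k) :=
  ∑ i, (ρ.withDensity (a i)).map fun ω => TreeSpace.mk i (r ω)

theorem TreeSpace.measurable_mk (i : Fin k) : Measurable (TreeSpace.mk i) :=
  (TreeSpace.isometry_mk i).continuous.measurable

theorem lintegral_spread (ρ : Measure Ω) {a : Fin k → Ω → ℝ≥0∞} (ha : ∀ i, Measurable (a i))
    {r : Ω → Icc (0 : ℝ) Real.pi} (hr : Measurable r) {f : TreeSpace k → ℝ≥0∞}
    (hf : Measurable f) :
    ∫⁻ p, f p ∂(spread ρ a r) = ∫⁻ ω, ∑ i, a i ω * f (TreeSpace.mk i (r ω)) ∂ρ := by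
  have hm (i : Fin k) : Measurable fun ω => TreeSpace.mk i (r ω) := (TreeSpace.measurable_mk i).comp hr
  unfold spread
  rw [lintegral_finsetSum_measure, lintegral_finsetSum
    (f := fun i ω => a i ω * f (TreeSpace.mk i (r ω))) _ fun i _ => (ha i).mul (hf.comp (hm i))]
  refine Finset.sum_congr rfl fun i _ => ?_
  rw [lintegral_map hf (hm i), lintegral_withDensity_eq_lintegral_mul _ (ha i)
    (show Measurable fun ω => f (TreeSpace.mk i (r ω)) from hf.comp (hm i))]
  rfl

theorem spread_univ (ρ : Measure Ω) {a : Fin k → Ω → ℝ≥0∞} (ha : ∀ i, Measurable (a i))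
    {r : Ω → Icc (0 : ℝ) Real.pi} (hr : Measurable r) :
    spread ρ a r univ = ∫⁻ ω, ∑ i, a i ω ∂ρ := by
  simpa using lintegral_spread ρ ha hr (f := 1) measurable_one

theorem spread_add (ρ : Measure Ω) {a b : Fin k → Ω → ℝ≥0∞} (ha : ∀ i, Measurable (a i))
    {r : Ω → Icc (0 : ℝ) Real.pi} (hr : Measurable r) :
    spread ρ (fun i => a i + b i) r = spread ρ a r + spread ρ b r := by
  unfold spread
  rw [← Finset.sum_add_distrib]
  refine Finset.sum_congr rfl fun i _ => ?_
  rw [withDensity_add_left (ha i), Measure.map_add _ _ (f := fun ω => TreeSpace.mk i (r ω))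
    ((TreeSpace.measurable_mk i).comp hr)]

theorem wasserstein_finsetSum_le {X ι : Type*} [MetricSpace X] [MeasurableSpace X]
    [OpensMeasurableSpace X] [SecondCountableTopology X] (s : Finset ι) (μ ν : ι → Measure X) :
    wasserstein (∑ i ∈ s, μ i) (∑ i ∈ s, ν i) ≤ ∑ i ∈ s, wasserstein (μ i) (ν i) := by
  classical
  induction s using Finset.induction_on with
  | empty => simp [wasserstein_self]
  | insert i s hi ih =>
    rw [Finset.sum_insert hi, Finset.sum_insert hi, Finset.sum_insert hi]
    exact (wasserstein_add_le _ _ _ _).trans (by gcongr)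

/-- Every portion of mass stays on its ray and slides from the old coordinate to the new one. -/
theorem wasserstein_spread_coord_le (ρ : Measure Ω) {a : Fin k → Ω → ℝ≥0∞}
    (ha : ∀ i, Measurable (a i)) {r r' : Ω → Icc (0 : ℝ) Real.pi} (hr : Measurable r)
    (hr' : Measurable r') :
    wasserstein (spread ρ a r) (spread ρ a r') ≤
      ∫⁻ ω, ∑ i, a i ω * edist (r ω) (r' ω) ∂ρ := by
  refine (wasserstein_finsetSum_le _ _ _).trans ?_
  rw [lintegral_finsetSum (f := fun i ω => a i ω * edist (r ω) (r' ω)) _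
    fun i _ => (ha i).mul (hr.edist hr')]
  refine Finset.sum_le_sum fun i _ => ?_
  refine (wasserstein_map_le _ ((TreeSpace.measurable_mk i).comp hr)
    ((TreeSpace.measurable_mk i).comp hr')).trans_eq ?_
  refine (lintegral_congr fun ω => (TreeSpace.isometry_mk i).edist_eq _ _).trans ?_
  rw [lintegral_withDensity_eq_lintegral_mul _ (ha i) (hr.edist hr')]
  rfl

/-- The common part a ⊓ b stays in place. What remains are the excesses a - b and b - a (truncated
subtraction), of equal mass, transported at a cost of at most the diameter bound 2π. -/
theorem wasserstein_spread_density_le (ρ : Measure Ω) [IsFiniteMeasure ρ]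
    {a b : Fin k → Ω → ℝ≥0∞}
    (ha : ∀ i, Measurable (a i)) (hb : ∀ i, Measurable (b i))
    (ha₁ : ∀ ω, ∑ i, a i ω = 1) (hb₁ : ∀ ω, ∑ i, b i ω = 1)
    {r : Ω → Icc (0 : ℝ) Real.pi} (hr : Measurable r) :
    wasserstein (spread ρ a r) (spread ρ b r) ≤
      ENNReal.ofReal (2 * Real.pi) * ∫⁻ ω, ∑ i, (a i ω - b i ω) ∂ρ := by
  have key {a b : Fin k → Ω → ℝ≥0∞} (ha : ∀ i, Measurable (a i)) (hb : ∀ i, Measurable (b i)) :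
      spread ρ a r = spread ρ (fun i => a i ⊓ b i) r + spread ρ (fun i => a i - b i) r := by
    rw [← spread_add ρ (fun i => (ha i).inf (hb i)) hr]
    congr with i ω
    rw [add_comm]
    exact (tsub_add_min).symm
  have ua : spread ρ a r univ = ρ univ := by simp [spread_univ ρ ha hr, ha₁]
  have ub : spread ρ b r univ = ρ univ := by simp [spread_univ ρ hb hr, hb₁]
  have ka := key ha hb
  have kb := key hb ha
  simp_rw [inf_comm (b _)] at kb
  have ea := congrArg (fun m : Measure (TreeSpace k) => m univ) ka
  have eb := congrArg (fun m : Measure (TreeSpace k) => m univ) kb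
  simp only [ua, ub, Measure.add_apply] at ea eb
  have hfin (t : ℝ≥0∞) (ht : t ≤ ρ univ) : t < ∞ := ht.trans_lt (measure_lt_top _ _)
  have h₁ : IsFiniteMeasure (spread ρ (fun i => a i - b i) r) :=
    ⟨hfin _ (by rw [ea]; exact le_add_self)⟩
  have h₂ : IsFiniteMeasure (spread ρ (fun i => b i - a i) r) :=
    ⟨hfin _ (by rw [eb]; exact le_add_self)⟩
  have h₀ : spread ρ (fun i => a i ⊓ b i) r univ ≠ ∞ :=
    (hfin _ (by rw [ea]; exact le_self_add)).ne
  rw [ka, kb]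
  refine (wasserstein_add_le _ _ _ _).trans ?_
  rw [wasserstein_self, zero_add]
  refine (wasserstein_le_of_edist_le TreeSpace.edist_le ?_).trans_eq ?_
  -- Both totals are the mass of `ρ`; cancelling the finite common part shows that the excesses
  -- balance.
  · exact (ENNReal.add_right_inj h₀).1 (ea.symm.trans eb)
  · rw [spread_univ ρ (fun i => (ha i).sub (hb i)) hr]
    rfl

end Spread

/-! ### Radon transform: continuity in the tree and equivariance. -/

section Radon

variable {d k : ℕ}

theorem continuous_root : Continuous (SphTree.root : SphTree d k → Sph d) :=
  continuous_fst.comp continuous_subtype_val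

theorem continuous_sphCoord : Continuous fun p : Sph d × Sph d => sphCoord p.1 p.2 := by
  unfold sphCoord
  fun_prop

theorem continuous_sphCoord_root :
    Continuous fun p : SphTree d k × Sph d => sphCoord p.1.root p.2 := by
  have h : Continuous fun p : SphTree d k × Sph d => (p.1.root, p.2) :=
    (continuous_root.comp continuous_fst).prodMk continuous_snd
  simpa only [Function.comp_def] using continuous_sphCoord.comp h

/-- The density of the splitting map on the `i`-th ray. -/
noncomputable def density (α : SplittingMap d k) (T : SphTree d k) (i : Fin k) (y : Sph d) :
    ℝ≥0∞ :=
  ENNReal.ofReal ((α (y, T) : Fin k → ℝ) i)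

theorem measurable_density (α : SplittingMap d k) (T : SphTree d k) (i : Fin k) :
    Measurable (density α T i) := by
  refine Continuous.measurable (ENNReal.continuous_ofReal.comp ?_)
  exact (continuous_apply i).comp (continuous_subtype_val.comp
    (α.continuous.comp (Continuous.prodMk_left T)))

theorem sum_density (α : SplittingMap d k) (T : SphTree d k) (y : Sph d) :
    ∑ i, density α T i y = 1 := by
  unfold density
  rw [← ENNReal.ofReal_sum_of_nonneg fun i _ => stdSimplex.zero_le _ i, stdSimplex.sum_eq_one,
    ENNReal.ofReal_one]

theorem measurable_sphCoord (x : Sph d) : Measurable (sphCoord x) :=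
  (continuous_sphCoord.comp (Continuous.prodMk_right x)).measurable

theorem radon_eq_spread (α : SplittingMap d k) (T : SphTree d k) (μ : Measure (Sph d)) :
    radon α T μ = spread μ (density α T) (sphCoord T.root) :=
  rfl

instance (α : SplittingMap d k) (T : SphTree d k) (μ : Measure (Sph d))
    [IsProbabilityMeasure μ] : IsProbabilityMeasure (radon α T μ) := by
  refine ⟨?_⟩
  rw [radon_eq_spread, spread_univ _ (measurable_density α T) (measurable_sphCoord _)]
  simp [sum_density]

/-- The splitting map as a continuous family of maps on the sphere. -/
noncomputable def curriedSplitting (α : SplittingMap d k) :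
    C(SphTree d k, C(Sph d, stdSimplex ℝ (Fin k))) :=
  ContinuousMap.curry ⟨fun p => α (p.2, p.1), by fun_prop⟩

/-- The spherical distance to the root as a continuous family of maps on the sphere. -/
noncomputable def curriedCoord : C(SphTree d k, C(Sph d, Icc (0 : ℝ) Real.pi)) :=
  ContinuousMap.curry ⟨fun p => sphCoord p.1.root p.2, continuous_sphCoord_root⟩

theorem edist_apply_le {Y Z : Type*} [TopologicalSpace Y] [CompactSpace Y]
    [PseudoMetricSpace Z] (f g : C(Y, Z)) (y : Y) : edist (f y) (g y) ≤ edist f g := by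
  rw [edist_dist, edist_dist]
  exact ENNReal.ofReal_le_ofReal (ContinuousMap.dist_apply_le_dist y)

theorem density_sub_le (α : SplittingMap d k) (T T' : SphTree d k) (i : Fin k) (y : Sph d) :
    density α T i y - density α T' i y ≤ edist (curriedSplitting α T) (curriedSplitting α T') := by
  refine le_trans ?_ (edist_apply_le _ _ y)
  refine le_trans ?_ (edist_le_pi_edist (α (y, T)).1 (α (y, T')).1 i)
  unfold density
  rw [← ENNReal.ofReal_sub _ (stdSimplex.zero_le _ i), edist_dist, Real.dist_eq]
  exact ENNReal.ofReal_le_ofReal (le_abs_self _)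

/-- A modulus of continuity of the Radon transform in the tree. -/
noncomputable def radonModulus (α : SplittingMap d k) (T T' : SphTree d k) : ℝ≥0∞ :=
  edist (curriedCoord T) (curriedCoord T') +
    ENNReal.ofReal (2 * Real.pi) * (k * edist (curriedSplitting α T) (curriedSplitting α T'))

/-- The intermediate measure keeps the densities of T but uses the root of T', so coordinates and
densities change one at a time. -/
theorem wasserstein_radon_le (α : SplittingMap d k) (T T' : SphTree d k)
    (μ : ProbabilityMeasure (Sph d)) (hk : 1 ≤ k) :
    wasserstein (radon α T μ) (radon α T' μ) ≤ radonModulus α T T' := by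
  -- Conditional kernels need a nonempty space; with k = 0 the tree would be empty.
  have : Nonempty (TreeSpace k) := ⟨TreeSpace.mk ⟨0, hk⟩ ⟨0, by simp [Real.pi_nonneg]⟩⟩
  have mid : IsFiniteMeasure (spread (μ : Measure (Sph d)) (density α T) (sphCoord T'.root)) :=
    ⟨by simp [spread_univ _ (measurable_density α T) (measurable_sphCoord _), sum_density]⟩
  refine (wasserstein_triangle _ (spread (μ : Measure (Sph d)) (density α T)
    (sphCoord T'.root)) _).trans (add_le_add ?_ ?_)
  · refine (wasserstein_spread_coord_le _ (measurable_density α T) (measurable_sphCoord _)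
      (measurable_sphCoord _)).trans ?_
    simp_rw [← Finset.sum_mul, sum_density, one_mul]
    refine (lintegral_mono fun y => edist_apply_le (curriedCoord T) (curriedCoord T') y).trans ?_
    simp
  · refine (wasserstein_spread_density_le _ (measurable_density α T) (measurable_density α T')
      (sum_density α T) (sum_density α T') (measurable_sphCoord _)).trans ?_
    gcongr
    refine (lintegral_mono fun y => Finset.sum_le_sum fun i _ =>
      density_sub_le α T T' i y).trans ?_
    simp

/-- Currying over the compact sphere makes the splitting and the coordinate continuous in T for the
uniform distance. -/
theorem tendsto_radonModulus (α : SplittingMap d k) (T : SphTree d k) :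
    Filter.Tendsto (fun T' => radonModulus α T' T) (nhds T) (nhds 0) := by
  have h₁ : Continuous fun T' : SphTree d k => edist (curriedCoord T') (curriedCoord T) := by fun_prop
  have h₂ : Continuous fun T' => edist (curriedSplitting α T') (curriedSplitting α T) := by
    fun_prop
  have h : Continuous fun T' => radonModulus α T' T :=
    h₁.add ((ENNReal.continuous_const_mul ENNReal.ofReal_ne_top).comp
      ((ENNReal.continuous_const_mul (ENNReal.natCast_ne_top k)).comp h₂))
  simpa [radonModulus] using h.tendsto T

theorem radonModulus_comm (α : SplittingMap d k) (T T' : SphTree d k) :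
    radonModulus α T T' = radonModulus α T' T := by
  simp only [radonModulus, edist_comm]

theorem treeWasserstein_triangle (α : SplittingMap d k) (hk : 1 ≤ k)
    (μ ν ρ : ProbabilityMeasure (Sph d)) (T : SphTree d k) :
    treeWasserstein α μ ρ T ≤ treeWasserstein α μ ν T + treeWasserstein α ν ρ T := by
  have : Nonempty (TreeSpace k) := ⟨TreeSpace.mk ⟨0, hk⟩ ⟨0, by simp [Real.pi_nonneg]⟩⟩
  exact wasserstein_triangle _ _ _

theorem treeWasserstein_comm (α : SplittingMap d k) (μ ν : ProbabilityMeasure (Sph d))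
    (T : SphTree d k) : treeWasserstein α μ ν T = treeWasserstein α ν μ T :=
  wasserstein_comm _ _

theorem treeWasserstein_le (α : SplittingMap d k) (μ ν : ProbabilityMeasure (Sph d))
    (T : SphTree d k) : treeWasserstein α μ ν T ≤ ENNReal.ofReal (2 * Real.pi) :=
  (wasserstein_le_of_edist_le TreeSpace.edist_le (by simp)).trans_eq (by simp)

theorem treeWasserstein_le_add (α : SplittingMap d k) (hk : 1 ≤ k)
    (μ ν : ProbabilityMeasure (Sph d)) (T T' : SphTree d k) :
    treeWasserstein α μ ν T ≤ treeWasserstein α μ ν T' + 2 * radonModulus α T T' := by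
  have : Nonempty (TreeSpace k) := ⟨TreeSpace.mk ⟨0, hk⟩ ⟨0, by simp [Real.pi_nonneg]⟩⟩
  unfold treeWasserstein
  have h₁ := wasserstein_radon_le α T T' μ hk
  have h₂ := wasserstein_radon_le α T' T ν hk
  rw [radonModulus_comm] at h₂
  have h₃ := wasserstein_triangle (radon α T μ) (radon α T' μ) (radon α T ν)
  have h₄ := wasserstein_triangle (radon α T' μ) (radon α T' ν) (radon α T ν)
  calc _ ≤ radonModulus α T T' +
        (wasserstein (radon α T' μ) (radon α T' ν) + radonModulus α T T') :=
        h₃.trans (add_le_add h₁ (h₄.trans (by gcongr)))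
    _ = _ := by ring

theorem continuous_treeWasserstein (α : SplittingMap d k) (hk : 1 ≤ k)
    (μ ν : ProbabilityMeasure (Sph d)) : Continuous (treeWasserstein α μ ν) := by
  rw [continuous_iff_continuousAt]
  intro T
  have hz := (ENNReal.Tendsto.const_mul (tendsto_radonModulus α T) (Or.inr ENNReal.ofNat_ne_top) :
    Filter.Tendsto (fun T' => 2 * radonModulus α T' T) (nhds T) (nhds (2 * 0)))
  rw [mul_zero] at hz
  have hne : treeWasserstein α μ ν T ≠ ∞ :=
    ((treeWasserstein_le α μ ν T).trans_lt ENNReal.ofReal_lt_top).ne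
  refine tendsto_of_tendsto_of_tendsto_of_le_of_le
    (g := fun T' => treeWasserstein α μ ν T - 2 * radonModulus α T' T)
    (h := fun T' => treeWasserstein α μ ν T + 2 * radonModulus α T' T) ?_ ?_ ?_ ?_
  · simpa using ENNReal.Tendsto.sub tendsto_const_nhds hz (Or.inl hne)
  · simpa using tendsto_const_nhds.add hz
  · intro T'
    rw [tsub_le_iff_right]
    simpa [radonModulus_comm α T'] using treeWasserstein_le_add α hk μ ν T T'
  · intro T'
    exact treeWasserstein_le_add α hk μ ν T' T

theorem Orth.measurable_act (g : Orth d) : Measurable g.act :=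
  g.continuous_act.measurable

theorem sphCoord_act (g : Orth d) (x y : Sph d) : sphCoord (g.act x) (g.act y) = sphCoord x y := by
  simp [sphCoord, Orth.act]

/-- Both the coordinate ⟪x, y⟫ and the splitting are unchanged when g moves the tree and the point
together, so the change of variables y ↦ g y identifies the two measures. -/
theorem radon_act (α : SplittingMap d k) (hα : α.IsInvariant) (g : Orth d) (T : SphTree d k)
    (μ : Measure (Sph d)) : radon α (g.actTree T) (μ.map g.act) = radon α T μ := by
  ext s hs
  simp_rw [← lintegral_indicator_one hs]
  have hf : Measurable (s.indicator (1 : TreeSpace k → ℝ≥0∞)) := measurable_one.indicator hs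
  rw [radon_eq_spread, radon_eq_spread,
    lintegral_spread _ (measurable_density α _) (measurable_sphCoord _) hf,
    lintegral_spread _ (measurable_density α _) (measurable_sphCoord _) hf,
    lintegral_map _ g.measurable_act]
  · refine lintegral_congr fun y => Finset.sum_congr rfl fun i _ => ?_
    rw [show (g.actTree T).root = g.act T.root from rfl, sphCoord_act]
    unfold density
    rw [hα g y T]
  · exact Finset.measurable_sum _ fun i _ => (measurable_density α _ i).mul
      (hf.comp ((TreeSpace.measurable_mk i).comp (measurable_sphCoord _)))

theorem treeWasserstein_act (α : SplittingMap d k) (hα : α.IsInvariant) (g : Orth d)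
    (μ ν : ProbabilityMeasure (Sph d)) (T : SphTree d k) :
    treeWasserstein α (pushforward g μ) (pushforward g ν) (g.actTree T) =
      treeWasserstein α μ ν T := by
  have h (μ : ProbabilityMeasure (Sph d)) :
      ((pushforward g μ : ProbabilityMeasure (Sph d)) : Measure (Sph d)) =
        (μ : Measure (Sph d)).map g.act := rfl
  rw [treeWasserstein, h, h, radon_act α hα, radon_act α hα]
  rfl

end Radon

/-! ### Uniform measures on unit spheres. -/

section UniformSphere

variable {F G : Type*} [NormedAddCommGroup F] [InnerProductSpace ℝ F] [FiniteDimensional ℝ F]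
  [MeasurableSpace F] [BorelSpace F] [NormedAddCommGroup G] [InnerProductSpace ℝ G]
  [FiniteDimensional ℝ G] [MeasurableSpace G] [BorelSpace G]

instance [Nontrivial F] : IsProbabilityMeasure (uniformSphere F) := by
  refine ⟨?_⟩
  rw [uniformSphere, Measure.smul_apply, smul_eq_mul]
  refine ENNReal.inv_mul_cancel ?_ (measure_ne_top _ _)
  rw [Ne, Measure.measure_univ_eq_zero]
  exact Measure.toSphere_ne_zero _

instance : (uniformSphere F).IsOpenPosMeasure := by
  refine ⟨fun U hU hne => ?_⟩
  rw [uniformSphere, Measure.smul_apply, smul_eq_mul]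
  exact mul_ne_zero (ENNReal.inv_ne_zero.2 (measure_ne_top _ _)) (hU.measure_ne_zero _ hne)

/-- The map between unit spheres induced by a linear isometric equivalence. -/
def sphereMap (e : F ≃ₗᵢ[ℝ] G) (v : Metric.sphere (0 : F) 1) : Metric.sphere (0 : G) 1 :=
  ⟨e v, by simp⟩

omit [FiniteDimensional ℝ F] [MeasurableSpace F] [BorelSpace F] [FiniteDimensional ℝ G]
  [MeasurableSpace G] [BorelSpace G] in
theorem continuous_sphereMap (e : F ≃ₗᵢ[ℝ] G) : Continuous (sphereMap e) :=
  Continuous.subtype_mk (e.continuous.comp continuous_subtype_val) _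

/-- The surface measure of a set is a dimensional multiple of the volume of the cone over it, and a
linear isometry preserves volume and maps cones to cones. -/
theorem map_toSphere (e : F ≃ₗᵢ[ℝ] G) :
    (volume : Measure F).toSphere.map (sphereMap e) = (volume : Measure G).toSphere := by
  ext s hs
  have hm := (continuous_sphereMap e).measurable
  rw [Measure.map_apply hm hs, Measure.toSphere_apply' _ (hm hs), Measure.toSphere_apply' _ hs,
    e.toLinearEquiv.finrank_eq, ← e.measurePreserving.measure_preimage_equiv (f := e.toMeasurableEquiv)]
  congr 2
  ext v
  simp only [mem_preimage, mem_smul, mem_image]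
  constructor
  · rintro ⟨t, ht, _, ⟨u, hu, rfl⟩, rfl⟩
    exact ⟨t, ht, _, ⟨_, hu, rfl⟩, by simp [sphereMap]⟩
  · rintro ⟨t, ht, _, ⟨u, hu, rfl⟩, h⟩
    refine ⟨t, ht, _, ⟨sphereMap e.symm u, ?_, rfl⟩, ?_⟩
    · convert hu
      ext
      simp [sphereMap]
    · apply e.injective
      simpa [sphereMap] using h

theorem map_uniformSphere (e : F ≃ₗᵢ[ℝ] G) :
    (uniformSphere F).map (sphereMap e) = uniformSphere G := by
  have h := map_toSphere e
  have h₁ : (volume : Measure F).toSphere univ = (volume : Measure G).toSphere univ := by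
    rw [← h, Measure.map_apply (continuous_sphereMap e).measurable .univ, preimage_univ]
  rw [uniformSphere, uniformSphere, Measure.map_smul, h, h₁]

/-- The cone over a point lies in a line, a proper subspace in dimension at least two, hence null.
-/
theorem nullSingletonClass_uniformSphere (hF : 2 ≤ Module.finrank ℝ F) : NullSingletonClass (uniformSphere F) := by
  refine ⟨fun v => ?_⟩
  rw [uniformSphere, Measure.smul_apply, smul_eq_mul,
    Measure.toSphere_apply' _ (measurableSet_singleton v)]
  have hne : Submodule.span ℝ {(v : F)} ≠ ⊤ := by
    intro h
    have := finrank_span_singleton (K := ℝ) (ne_zero_of_mem_unit_sphere v)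
    rw [h, finrank_top] at this
    omega
  have hz : (volume : Measure F) (Ioo (0 : ℝ) 1 • (Subtype.val '' {v})) = 0 := by
    refine measure_mono_null ?_ (Measure.addHaar_submodule volume _ hne)
    rw [image_singleton]
    rintro _ ⟨t, -, _, rfl, rfl⟩
    exact Submodule.smul_mem _ _ (Submodule.mem_span_singleton_self _)
  rw [hz, mul_zero, mul_zero]

end UniformSphere

/-! ### Law of the edge directions at a given root. -/

section Directions

variable {d k : ℕ}

/-- The inclusion of the unit sphere of a subspace into the sphere. -/
def sphereIncl (V : Submodule ℝ (Euc d)) (v : Metric.sphere (0 : V) 1) : Sph d :=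
  ⟨(v.1 : Euc d), by
    have h := v.2
    rw [mem_sphere_zero_iff_norm] at h ⊢
    exact h⟩

theorem continuous_sphereIncl (V : Submodule ℝ (Euc d)) : Continuous (sphereIncl V) :=
  Continuous.subtype_mk (continuous_subtype_val.comp continuous_subtype_val) _

theorem injective_sphereIncl (V : Submodule ℝ (Euc d)) : Function.Injective (sphereIncl V) :=
  fun _ _ h => Subtype.ext (Subtype.ext (congrArg (fun z : Sph d => (z : Euc d)) h))

/-- The uniform distribution on the unit vectors of a subspace. -/
noncomputable def subspaceLaw (V : Submodule ℝ (Euc d)) : Measure (Sph d) :=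
  (uniformSphere V).map (sphereIncl V)

theorem uniformDirection_eq (x : Sph d) :
    uniformDirection x = subspaceLaw (Submodule.span ℝ {(x : Euc d)})ᗮ :=
  rfl

theorem map_subspaceLaw (g : Orth d) (V : Submodule ℝ (Euc d)) :
    (subspaceLaw V).map g.act = subspaceLaw (V.map (g.toLinearEquiv : Euc d →ₗ[ℝ] Euc d)) := by
  obtain ⟨e, he⟩ : ∃ e : V ≃ₗᵢ[ℝ] V.map (g.toLinearEquiv : Euc d →ₗ[ℝ] Euc d),
      ∀ v, (e v : Euc d) = g v := ⟨LinearIsometryEquiv.submoduleMap V g, fun _ => rfl⟩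
  rw [subspaceLaw, subspaceLaw, ← map_uniformSphere e,
    Measure.map_map g.measurable_act (continuous_sphereIncl _).measurable,
    Measure.map_map (continuous_sphereIncl _).measurable (continuous_sphereMap _).measurable]
  congr 1
  ext1 v
  exact Subtype.ext (he v.1).symm

/-- An orthogonal g carries the hyperplane orthogonal to x onto the one orthogonal to g x. -/
theorem map_uniformDirection (g : Orth d) (x : Sph d) :
    (uniformDirection x).map g.act = uniformDirection (g.act x) := by
  rw [uniformDirection_eq, uniformDirection_eq, map_subspaceLaw]
  congr 1
  rw [Submodule.map_orthogonal_equiv, Submodule.map_span, image_singleton]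
  rfl

theorem finrank_orthogonal (x : Sph d) :
    Module.finrank ℝ (Submodule.span ℝ {(x : Euc d)})ᗮ = d := by
  have : Fact (Module.finrank ℝ (Euc d) = d + 1) := ⟨by simp⟩
  exact Submodule.finrank_orthogonal_span_singleton (ne_zero_of_mem_unit_sphere x)

theorem isProbabilityMeasure_uniformDirection (hd : 1 ≤ d) (x : Sph d) :
    IsProbabilityMeasure (uniformDirection x) := by
  have : Nontrivial (Submodule.span ℝ {(x : Euc d)})ᗮ := by
    apply Module.nontrivial_of_finrank_pos (R := ℝ)
    rw [finrank_orthogonal]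
    omega
  rw [uniformDirection_eq, subspaceLaw]
  exact Measure.isProbabilityMeasure_map (continuous_sphereIncl _).aemeasurable

theorem nullSingletonClass_uniformDirection (hd : 2 ≤ d) (x : Sph d) : NullSingletonClass (uniformDirection x) := by
  have := nullSingletonClass_uniformSphere (F := (Submodule.span ℝ {(x : Euc d)})ᗮ)
    (by rw [finrank_orthogonal]; exact hd)
  refine ⟨fun y => ?_⟩
  rw [uniformDirection_eq, subspaceLaw,
    Measure.map_apply (continuous_sphereIncl _).measurable (measurableSet_singleton y)]
  exact (subsingleton_singleton.preimage (injective_sphereIncl _)).measure_zero _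

theorem ae_uniformDirection_inner (x : Sph d) :
    ∀ᵐ y : Sph d ∂uniformDirection x, ⟪(x : Euc d), (y : Euc d)⟫ = 0 := by
  rw [uniformDirection_eq, subspaceLaw, ae_map_iff (continuous_sphereIncl _).aemeasurable
    (isClosed_eq (f := fun y : Sph d => ⟪(x : Euc d), (y : Euc d)⟫) (by fun_prop)
      continuous_const).measurableSet]
  exact .of_forall fun v => Submodule.mem_orthogonal_singleton_iff_inner_right.1 v.1.2

/-- A fixed point of the sphere. -/
noncomputable def basePoint (d : ℕ) : Sph d :=
  ⟨EuclideanSpace.single 0 1, by simp⟩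

/-- The reflection that moves the base point to `x`. -/
noncomputable def moveBase (x : Sph d) : Orth d :=
  (Submodule.span ℝ {(basePoint d : Euc d) - x})ᗮ.reflection

theorem moveBase_basePoint (x : Sph d) : (moveBase x).act (basePoint d) = x := by
  apply Subtype.ext
  exact Submodule.reflection_sub (by simp)

theorem measurable_moveBase : Measurable fun p : Sph d × Sph d => (moveBase p.1).act p.2 := by
  refine Measurable.subtype_mk ?_
  -- The reflection has an explicit formula with denominator ‖basePoint - x‖². At x = `basePoint d`
  -- the division by zero gives 0 and the formula yields the identity, so measurability holds with
  -- no exceptional point.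
  unfold moveBase
  simp only [Submodule.reflection_orthogonal_apply, Submodule.reflection_singleton_apply, two_smul,
    RCLike.ofReal_real_eq_id, id_eq]
  fun_prop

/-- The law of the tree with root `x`. -/
noncomputable def fiberLaw (k : ℕ) (x : Sph d) : Measure (Sph d × (Fin k → Sph d)) :=
  (Measure.pi fun _ : Fin k => uniformDirection x).map fun y => (x, y)

theorem Orth.measurable_act_pi (g : Orth d) :
    Measurable fun (y : Fin k → Sph d) i => g.act (y i) :=
  measurable_pi_lambda _ fun i => g.measurable_act.comp (measurable_pi_apply i)

theorem map_pi_uniformDirection (hd : 1 ≤ d) (g : Orth d) (x : Sph d) :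
    (Measure.pi fun _ : Fin k => uniformDirection x).map (fun y i => g.act (y i)) =
      Measure.pi fun _ : Fin k => uniformDirection (g.act x) := by
  have := fun x : Sph d => isProbabilityMeasure_uniformDirection hd x
  have : SigmaFinite ((uniformDirection x).map g.act) := by
    rw [map_uniformDirection]
    infer_instance
  rw [Measure.pi_map_pi fun _ => g.measurable_act.aemeasurable]
  simp_rw [map_uniformDirection]

/-- The sphere of directions varies with x. The reflection `moveBase x` transports the directions at
the base point to those at x, so the law is the image of one fixed measure under a jointly
measurable map. -/
theorem measurable_fiberLaw (hd : 1 ≤ d) :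
    Measurable (fiberLaw k : Sph d → Measure (Sph d × (Fin k → Sph d))) := by
  have := fun x : Sph d => isProbabilityMeasure_uniformDirection hd x
  have hm : Measurable fun p : Sph d × (Fin k → Sph d) =>
      (p.1, fun i => (moveBase p.1).act (p.2 i)) :=
    measurable_fst.prodMk (measurable_pi_lambda _ fun i => by
      have hi : Measurable fun p : Sph d × (Fin k → Sph d) => (p.1, p.2 i) := by fun_prop
      simpa only [Function.comp_def] using measurable_moveBase.comp hi)
  have h (x : Sph d) : fiberLaw k x =
      (Measure.pi fun _ : Fin k => uniformDirection (basePoint d)).map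
        fun y => (x, fun i => (moveBase x).act (y i)) := by
    have e := map_pi_uniformDirection (k := k) hd (moveBase x) (basePoint d)
    rw [moveBase_basePoint] at e
    rw [fiberLaw, ← e, Measure.map_map measurable_prodMk_left (moveBase x).measurable_act_pi]
    rfl
  refine Measure.measurable_of_measurable_coe _ fun s hs => ?_
  simp_rw [h]
  have hx (x : Sph d) : Measurable fun y : Fin k → Sph d =>
      (x, fun i => (moveBase x).act (y i)) := hm.comp measurable_prodMk_left
  have e : (fun x => (Measure.pi fun _ : Fin k => uniformDirection (basePoint d)).map
      (fun y => (x, fun i => (moveBase x).act (y i))) s) = fun x =>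
      (Measure.pi fun _ : Fin k => uniformDirection (basePoint d)) (Prod.mk x ⁻¹'
        ((fun p : Sph d × (Fin k → Sph d) => (p.1, fun i => (moveBase p.1).act (p.2 i))) ⁻¹' s)) :=
    funext fun x => Measure.map_apply (hx x) hs
  rw [e]
  exact measurable_measure_prodMk_left (hm hs)

theorem measurableSet_tree (d k : ℕ) : MeasurableSet {p : Sph d × (Fin k → Sph d) |
    (∀ i, ⟪(p.1 : Euc d), (p.2 i : Euc d)⟫ = 0) ∧ (2 ≤ d → Function.Injective p.2)} := by
  have h₁ (i : Fin k) : MeasurableSet {p : Sph d × (Fin k → Sph d) |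
      ⟪(p.1 : Euc d), (p.2 i : Euc d)⟫ = 0} :=
    (isClosed_eq (by fun_prop) continuous_const).measurableSet
  have h₂ (i j : Fin k) : MeasurableSet {p : Sph d × (Fin k → Sph d) | p.2 i = p.2 j} :=
    (isClosed_eq (by fun_prop) (by fun_prop)).measurableSet
  simp only [Function.Injective, ofPred_and, ofPred_forall]
  refine (MeasurableSet.iInter h₁).inter (MeasurableSet.iInter fun _ => MeasurableSet.iInter
    fun i => MeasurableSet.iInter fun j => (h₂ i j).imp (.const _))

/-- Two distinct coordinates have joint law m × m, and by Fubini its diagonal is null because each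
slice is a single point. -/
theorem measure_pi_setOf_eq {Y : Type*} [MeasurableSpace Y] [MeasurableEq Y]
    (m : Measure Y) [IsProbabilityMeasure m] [NullSingletonClass m] {i j : Fin k} (hij : i ≠ j) :
    (Measure.pi fun _ : Fin k => m) {y | y i = y j} = 0 := by
  have hm i := (measurePreserving_eval (fun _ : Fin k => m) i).map_eq
  have hI := (ProbabilityTheory.iIndepFun_pi (μ := fun _ : Fin k => m) (X := fun _ y => y)
    fun _ => aemeasurable_id).indepFun hij
  rw [ProbabilityTheory.indepFun_iff_map_prod_eq_prod_map_map
    (measurable_pi_apply i).aemeasurable (measurable_pi_apply j).aemeasurable] at hI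
  have hs : MeasurableSet {p : Y × Y | p.1 = p.2} :=
    measurableSet_eq_fun measurable_fst measurable_snd
  have e : (Measure.pi fun _ : Fin k => m) {y | y i = y j} =
      ((Measure.pi fun _ : Fin k => m).map fun y => (y i, y j)) {p : Y × Y | p.1 = p.2} := by
    rw [Measure.map_apply (by fun_prop) hs]
    rfl
  rw [e, hI]
  have h₀ : (m.prod m) {p : Y × Y | p.1 = p.2} = 0 := by
    rw [Measure.measure_prod_null hs]
    refine .of_forall fun x => ?_
    have : Prod.mk x ⁻¹' {p : Y × Y | p.1 = p.2} = {x} := by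
      ext y
      simp [eq_comm]
    simp [this]
  convert h₀
  · exact hm i
  · exact hm j

/-- For d ≥ 2 the direction law has no atoms, so directions are almost surely distinct; for d = 1 no
distinctness is demanded. -/
theorem ae_fiberLaw (hd : 1 ≤ d) (x : Sph d) :
    ∀ᵐ p ∂fiberLaw k x, (∀ i, ⟪(p.1 : Euc d), (p.2 i : Euc d)⟫ = 0) ∧
      (2 ≤ d → Function.Injective p.2) := by
  have := isProbabilityMeasure_uniformDirection hd x
  rw [fiberLaw, ae_map_iff measurable_prodMk_left.aemeasurable (measurableSet_tree d k)]
  refine Filter.Eventually.and ?_ ?_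
  · rw [ae_all_iff]
    exact fun i => (measurePreserving_eval (fun _ : Fin k => uniformDirection x)
      i).quasiMeasurePreserving.ae (ae_uniformDirection_inner x)
  · by_cases h : 2 ≤ d
    · have := nullSingletonClass_uniformDirection h x
      have hij : ∀ᵐ y ∂(Measure.pi fun _ : Fin k => uniformDirection x),
          ∀ i j, i ≠ j → y i ≠ y j := by
        simp only [ae_all_iff]
        intro i j hij
        simpa [ae_iff] using measure_pi_setOf_eq (uniformDirection x) hij
      filter_upwards [hij] with y hy _ i j hyij
      by_contra hne
      exact hy i j hne hyij
    · exact .of_forall fun _ h' => absurd h' h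

end Directions

/-! ### The law of random trees and its invariance. -/

section TreeLaw

variable {d k : ℕ}

theorem rootedLaw_eq (d k : ℕ) : rootedLaw d k = (uniformSphere (Euc d)).bind (fiberLaw k) :=
  rfl

theorem map_rootedLaw {Y : Type*} [MeasurableSpace Y] (hd : 1 ≤ d)
    {f : Sph d × (Fin k → Sph d) → Y} (hf : Measurable f) :
    (rootedLaw d k).map f = (uniformSphere (Euc d)).bind fun x => (fiberLaw k x).map f := by
  ext s hs
  have hm := measurable_fiberLaw (k := k) hd
  rw [Measure.map_apply hf hs, rootedLaw_eq, Measure.bind_apply (hf hs) hm.aemeasurable,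
    Measure.bind_apply (f := fun x => (fiberLaw k x).map f) hs
      ((Measure.measurable_map f hf).comp hm).aemeasurable]
  simp_rw [Measure.map_apply hf hs]

theorem map_fst_rootedLaw (hd : 1 ≤ d) :
    (rootedLaw d k).map Prod.fst = uniformSphere (Euc d) := by
  have := fun x : Sph d => isProbabilityMeasure_uniformDirection hd x
  rw [map_rootedLaw hd measurable_fst]
  have h (x : Sph d) : (fiberLaw k x).map Prod.fst = Measure.dirac x := by
    rw [fiberLaw, Measure.map_map measurable_fst measurable_prodMk_left]
    change Measure.map (fun _ => x) _ = _
    simp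
  simp_rw [h]
  exact Measure.bind_dirac

/-- Moving the fibre over x by g gives the fibre over g x, and the uniform law of the root is
invariant under x ↦ g x. -/
theorem map_act_rootedLaw (hd : 1 ≤ d) (g : Orth d) :
    (rootedLaw d k).map (fun p => (g.act p.1, fun i => g.act (p.2 i))) = rootedLaw d k := by
  have ha (i : Fin k) : Measurable fun p : Sph d × (Fin k → Sph d) => g.act (p.2 i) :=
    g.measurable_act.comp (by fun_prop)
  have hg : Measurable fun p : Sph d × (Fin k → Sph d) =>
      (g.act p.1, fun i => g.act (p.2 i)) :=
    (g.measurable_act.comp measurable_fst).prodMk (measurable_pi_lambda _ ha)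
  have h (x : Sph d) : (fiberLaw k x).map (fun p => (g.act p.1, fun i => g.act (p.2 i))) =
      fiberLaw k (g.act x) := by
    rw [fiberLaw, fiberLaw, ← map_pi_uniformDirection hd, Measure.map_map hg measurable_prodMk_left,
      Measure.map_map measurable_prodMk_left g.measurable_act_pi]
    rfl
  rw [map_rootedLaw hd hg]
  simp_rw [h]
  ext s hs
  have hm := measurable_fiberLaw (k := k) hd
  rw [rootedLaw_eq, Measure.bind_apply hs hm.aemeasurable,
    Measure.bind_apply (f := fun x => fiberLaw k (g.act x)) hs
      (hm.comp g.measurable_act).aemeasurable]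
  conv_rhs => rw [← map_uniformSphere g]
  exact (lintegral_map (f := fun x => fiberLaw k x s)
    ((Measure.measurable_coe hs).comp hm) g.measurable_act).symm

instance : BorelSpace (SphTree d k) :=
  inferInstanceAs (BorelSpace {p : Sph d × (Fin k → Sph d) //
    (∀ i, ⟪(p.1 : Euc d), (p.2 i : Euc d)⟫ = 0) ∧ (2 ≤ d → Function.Injective p.2)})

/-- The root of a tree together with the directions of its edges. -/
def SphTree.toProd (T : SphTree d k) : Sph d × (Fin k → Sph d) :=
  T.1

theorem measurableEmbedding_toProd :
    MeasurableEmbedding (SphTree.toProd : SphTree d k → Sph d × (Fin k → Sph d)) :=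
  MeasurableEmbedding.subtype_coe (measurableSet_tree d k)

/-- Restricting to admissible tuples loses no mass, by `ae_fiberLaw`; this makes `treeLaw` a
probability measure with uniform root. -/
theorem map_toProd_treeLaw (hd : 1 ≤ d) :
    (treeLaw d k).map SphTree.toProd = rootedLaw d k := by
  have hm := measurable_fiberLaw (k := k) hd
  rw [show treeLaw d k = (rootedLaw d k).comap SphTree.toProd from rfl,
    measurableEmbedding_toProd.map_comap]
  refine Measure.restrict_eq_self_of_ae_mem ?_
  have hs := measurableSet_tree d k
  have hr : range (SphTree.toProd : SphTree d k → Sph d × (Fin k → Sph d)) =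
      {p : Sph d × (Fin k → Sph d) |
        (∀ i, ⟪(p.1 : Euc d), (p.2 i : Euc d)⟫ = 0) ∧ (2 ≤ d → Function.Injective p.2)} :=
    Subtype.range_val
  rw [hr, ae_iff, rootedLaw_eq]
  refine (Measure.bind_apply hs.compl hm.aemeasurable).trans ?_
  refine (lintegral_congr fun x => ?_).trans lintegral_zero
  exact ae_iff.1 (ae_fiberLaw hd x)

theorem map_root_treeLaw (hd : 1 ≤ d) :
    (treeLaw d k).map SphTree.root = uniformSphere (Euc d) := by
  rw [← map_fst_rootedLaw (k := k) hd, ← map_toProd_treeLaw hd,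
    Measure.map_map measurable_fst measurableEmbedding_toProd.measurable]
  rfl

theorem isProbabilityMeasure_treeLaw (hd : 1 ≤ d) : IsProbabilityMeasure (treeLaw d k) := by
  refine ⟨?_⟩
  rw [← preimage_univ (f := SphTree.root), ← Measure.map_apply continuous_root.measurable .univ,
    map_root_treeLaw hd, measure_univ]

theorem measurable_actTree (g : Orth d) : Measurable (g.actTree : SphTree d k → SphTree d k) := by
  refine Measurable.subtype_mk ?_
  have hv : Measurable (SphTree.toProd : SphTree d k → Sph d × (Fin k → Sph d)) :=
    measurableEmbedding_toProd.measurable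
  exact (g.measurable_act.comp hv.fst).prodMk (measurable_pi_lambda _ fun i =>
    g.measurable_act.comp ((measurable_pi_apply i).comp hv.snd))

theorem map_actTree_treeLaw (hd : 1 ≤ d) (g : Orth d) :
    (treeLaw d k).map g.actTree = treeLaw d k := by
  have hv := measurableEmbedding_toProd (d := d) (k := k)
  have hg : Measurable fun p : Sph d × (Fin k → Sph d) =>
      (g.act p.1, fun i => g.act (p.2 i)) :=
    (g.measurable_act.comp measurable_fst).prodMk (measurable_pi_lambda _ fun i =>
      g.measurable_act.comp ((measurable_pi_apply i).comp measurable_snd))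
  have h : ((treeLaw d k).map g.actTree).map SphTree.toProd = (treeLaw d k).map SphTree.toProd := by
    rw [Measure.map_map hv.measurable (measurable_actTree g), map_toProd_treeLaw hd]
    conv_rhs => rw [← map_act_rootedLaw hd g, ← map_toProd_treeLaw hd,
      Measure.map_map hg hv.measurable]
    rfl
  rw [← hv.comap_map ((treeLaw d k).map g.actTree), h, hv.comap_map]

end TreeLaw

/-! ### Definiteness, the metric axioms and invariance. -/

section Metric

variable {d k : ℕ}

/-- Forgetting the ray recombines the fractions of each mass, and these sum to 1, so the splitting
map disappears. -/
theorem integral_radon (α : SplittingMap d k) (T : SphTree d k) (μ : Measure (Sph d))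
    [IsProbabilityMeasure μ] {f : ℝ → ℂ} (hf : Continuous f) :
    ∫ p, f p.radius ∂(radon α T μ) = ∫ y, f (sphCoord T.root y) ∂μ := by
  have h : (radon α T μ).map TreeSpace.radius =
      μ.map fun y => (sphCoord T.root y : ℝ) := by
    have hr := (TreeSpace.lipschitzWith_radius (k := k)).continuous.measurable
    ext s hs
    rw [Measure.map_apply hr hs, Measure.map_apply (measurable_sphCoord _).subtype_val hs,
      ← lintegral_indicator_one (hr hs), radon_eq_spread,
      lintegral_spread _ (measurable_density α T) (measurable_sphCoord _)
        (measurable_one.indicator (hr hs)),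
      ← lintegral_indicator_one ((measurable_sphCoord _).subtype_val hs)]
    refine lintegral_congr fun y => ?_
    have (i : Fin k) : (TreeSpace.radius ⁻¹' s).indicator (1 : TreeSpace k → ℝ≥0∞)
        (TreeSpace.mk i (sphCoord T.root y)) =
        ((fun y => (sphCoord T.root y : ℝ)) ⁻¹' s).indicator 1 y := rfl
    simp_rw [this, ← Finset.sum_mul, sum_density, one_mul]
  rw [← integral_map (φ := TreeSpace.radius)
      TreeSpace.lipschitzWith_radius.continuous.measurable.aemeasurable
      hf.aestronglyMeasurable, h,
    integral_map (measurable_sphCoord _).subtype_val.aemeasurable hf.aestronglyMeasurable]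

/-- On the line through x the characteristic function depends on y only through the spherical
distance to x, which is what a tree rooted at x records. -/
theorem charFun_map_val (μ : Measure (Sph d)) (x : Sph d) (t : ℝ) :
    charFun (μ.map Subtype.val) (t • (x : Euc d)) =
      ∫ y, Complex.exp ((t * Real.cos (sphCoord x y) : ℝ) * Complex.I) ∂μ := by
  rw [charFun_apply, integral_map (by fun_prop) (by fun_prop)]
  refine integral_congr_ae (.of_forall fun y => ?_)
  have h : Real.cos (sphCoord x y) = ⟪(x : Euc d), (y : Euc d)⟫ := by
    refine Real.cos_arccos ?_ ?_
    · have := neg_le_of_abs_le (abs_real_inner_le_norm (x : Euc d) (y : Euc d))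
      simpa using this
    · simpa using real_inner_le_norm (x : Euc d) (y : Euc d)
  simp only [h, inner_smul_right, real_inner_comm]

theorem charFun_eq_of_treeWasserstein_eq_zero (α : SplittingMap d k)
    (μ ν : ProbabilityMeasure (Sph d)) (T : SphTree d k) (h : treeWasserstein α μ ν T = 0)
    (t : ℝ) :
    charFun ((μ : Measure (Sph d)).map Subtype.val) (t • (T.root : Euc d)) =
      charFun ((ν : Measure (Sph d)).map Subtype.val) (t • (T.root : Euc d)) := by
  let f : ℝ → ℂ := fun s => Complex.exp ((t * Real.cos s : ℝ) * Complex.I)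
  have hf : Continuous f := by fun_prop
  -- The constant |t| would do; adding 1 keeps it nonzero when t = 0, as the duality bound requires.
  have hL : LipschitzWith (‖t‖₊ + 1) f := by
    refine LipschitzWith.of_dist_le_mul fun s u => ?_
    have e : f s - f u = f u * (Complex.exp (Complex.I *
        ((t * (Real.cos s - Real.cos u) : ℝ) : ℂ)) - 1) := by
      simp only [f, mul_sub, ← Complex.exp_add, mul_one]
      congr 2
      push_cast
      ring
    rw [dist_eq_norm, e, norm_mul, Complex.norm_exp_ofReal_mul_I, one_mul]
    calc _ ≤ ‖t * (Real.cos s - Real.cos u)‖ := Real.norm_exp_I_mul_ofReal_sub_one_le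
      _ = |t| * |Real.cos s - Real.cos u| := by rw [Real.norm_eq_abs, abs_mul]
      _ ≤ (|t| + 1) * |s - u| := by
        exact mul_le_mul (by linarith) (Real.abs_cos_sub_cos_le s u) (abs_nonneg _) (by positivity)
      _ = _ := by simp [Real.dist_eq]
  have hL' : LipschitzWith (‖t‖₊ + 1) fun p : TreeSpace k => f p.radius := by
    simpa [Function.comp_def] using hL.comp TreeSpace.lipschitzWith_radius
  have hi (m : ProbabilityMeasure (Sph d)) :
      Integrable (fun p : TreeSpace k => f p.radius) (radon α T m) :=
    Integrable.of_bound hL'.continuous.aestronglyMeasurable 1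
      (.of_forall fun p => (Complex.norm_exp_ofReal_mul_I _).le)
  have := edist_integral_le_wasserstein hL' (by positivity) (hi μ) (hi ν)
  rw [show wasserstein (radon α T μ) (radon α T ν) = 0 from h, zero_mul, nonpos_iff_eq_zero,
    edist_eq_zero, integral_radon α T _ hf, integral_radon α T _ hf] at this
  rw [charFun_map_val, charFun_map_val]
  exact this

theorem eq_of_stsw_eq_zero (hd : 1 ≤ d) (hk : 1 ≤ k) (α : SplittingMap d k)
    (μ ν : ProbabilityMeasure (Sph d)) (h : stsw α μ ν = 0) : μ = ν := by
  have hm : Measurable (SphTree.root : SphTree d k → Sph d) := continuous_root.measurable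
  let φ (m : ProbabilityMeasure (Sph d)) : Euc d → ℂ :=
    charFun ((m : Measure (Sph d)).map Subtype.val)
  have hφ (m : ProbabilityMeasure (Sph d)) : Continuous (φ m) := by
    have : IsProbabilityMeasure ((m : Measure (Sph d)).map (Subtype.val : Sph d → Euc d)) :=
      Measure.isProbabilityMeasure_map (by fun_prop)
    exact continuous_charFun
  have hc : IsClosed {x : Sph d | ∀ t : ℝ, φ μ (t • (x : Euc d)) = φ ν (t • (x : Euc d))} := by
    rw [ofPred_forall]
    exact isClosed_iInter fun t => isClosed_eq ((hφ μ).comp (by fun_prop))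
      ((hφ ν).comp (by fun_prop))
  rw [stsw, lintegral_eq_zero_iff (continuous_treeWasserstein α hk μ ν).measurable] at h
  have ha : ∀ᵐ x ∂(uniformSphere (Euc d)),
      x ∈ {x : Sph d | ∀ t : ℝ, φ μ (t • (x : Euc d)) = φ ν (t • (x : Euc d))} := by
    rw [← map_root_treeLaw (k := k) hd]
    refine (ae_map_iff hm.aemeasurable hc.measurableSet).2 ?_
    filter_upwards [h] with T hT t
    exact charFun_eq_of_treeWasserstein_eq_zero α μ ν T hT t
  -- A closed set of full measure is everything, since the uniform law is positive on nonempty open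
  -- sets.
  have hu := hc.ae_eq_univ_iff_eq.1 (Filter.eventuallyEq_univ.2 ha)
  have he : (μ : Measure (Sph d)).map (Subtype.val : Sph d → Euc d) =
      (ν : Measure (Sph d)).map Subtype.val := by
    have (m : ProbabilityMeasure (Sph d)) :
        IsProbabilityMeasure ((m : Measure (Sph d)).map (Subtype.val : Sph d → Euc d)) :=
      Measure.isProbabilityMeasure_map (by fun_prop)
    refine Measure.ext_of_charFun (funext fun v => ?_)
    rcases eq_or_ne v 0 with rfl | hv
    · simp
    -- Polar coordinates: a nonzero v is ‖v‖ times a root.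
    have hx : ‖v‖⁻¹ • v ∈ Metric.sphere (0 : Euc d) 1 := by
      simp [norm_smul, hv]
    have := (eq_univ_iff_forall.1 hu ⟨_, hx⟩) ‖v‖
    simpa [φ, smul_smul, hv] using this
  have hs : MeasurableEmbedding (Subtype.val : Sph d → Euc d) :=
    MeasurableEmbedding.subtype_coe Metric.isClosed_sphere.measurableSet
  apply Subtype.ext
  have hμ := hs.comap_map (μ : Measure (Sph d))
  rw [he, hs.comap_map] at hμ
  exact hμ.symm

theorem stsw_ne_top (hd : 1 ≤ d) (α : SplittingMap d k) (μ ν : ProbabilityMeasure (Sph d)) :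
    stsw α μ ν ≠ ∞ := by
  have := isProbabilityMeasure_treeLaw (k := k) hd
  refine ((lintegral_mono fun T => treeWasserstein_le α μ ν T).trans_lt ?_).ne
  rw [lintegral_const, measure_univ, mul_one]
  exact ENNReal.ofReal_lt_top

theorem isMetric_stsw (hd : 1 ≤ d) (hk : 1 ≤ k) (α : SplittingMap d k) :
    IsMetric (stsw α) where
  ne_top := stsw_ne_top hd α
  eq_zero_iff μ ν := by
    refine ⟨eq_of_stsw_eq_zero hd hk α μ ν, ?_⟩
    rintro rfl
    simp [stsw, treeWasserstein, wasserstein_self]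
  symm μ ν := lintegral_congr fun T => treeWasserstein_comm α μ ν T
  triangle μ ν ρ := by
    unfold stsw
    rw [← lintegral_add_left (continuous_treeWasserstein α hk μ ν).measurable]
    exact lintegral_mono fun T => treeWasserstein_triangle α hk μ ν ρ T

theorem stsw_pushforward (hd : 1 ≤ d) (hk : 1 ≤ k) (α : SplittingMap d k) (hα : α.IsInvariant)
    (g : Orth d) (μ ν : ProbabilityMeasure (Sph d)) :
    stsw α (pushforward g μ) (pushforward g ν) = stsw α μ ν := by
  rw [stsw, ← map_actTree_treeLaw hd g,
    lintegral_map (continuous_treeWasserstein α hk _ _).measurable (measurable_actTree g)]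
  simp_rw [treeWasserstein_act α hα]
  rfl

end Metric

end STSW

theorem theorem5p1 (d k : ℕ) (hd : 1 ≤ d) (hk : 1 ≤ k) (α : STSW.SplittingMap d k)
    (hα : α.IsInvariant) :
    (∀ μ ν : MeasureTheory.ProbabilityMeasure (STSW.Sph d),
      Measurable (STSW.treeWasserstein α μ ν)) ∧
    STSW.IsMetric (STSW.stsw α) ∧
    ∀ (g : STSW.Orth d) (μ ν : MeasureTheory.ProbabilityMeasure (STSW.Sph d)),
      STSW.stsw α (STSW.pushforward g μ) (STSW.pushforward g ν) = STSW.stsw α μ ν :=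
  ⟨fun μ ν => (STSW.continuous_treeWasserstein α hk μ ν).measurable,
    STSW.isMetric_stsw hd hk α, STSW.stsw_pushforward hd hk α hα⟩
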